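/- For $d\in\mathbb N$ let $\mathcal M_d^{\mathrm{sa}}$ be the self-adjoint complex $d\times d$ matrices, $\le$ the positive semidefinite order, $\|\cdot\|_\infty$ the operator norm and $\|\cdot\|_1$ the Schatten $1$-norm (trace norm). For $\mathbf B=(B_1,\dots,B_g)\in(\mathcal M_d^{\mathrm{sa}})^g$ and $n\in\mathbb N$ let $$\mathcal D_{\mathbf B}(n)=\Big\{\mathbf X\in(\mathcal M_n^{\mathrm{sa}})^g:\ \sum_{i=1}^g B_i\otimes X_i\le I_d\otimes I_n\Big\},\qquad \mathcal D_{\square,g}(n)=\big\{\mathbf X\in(\mathcal M_n^{\mathrm{sa}})^g:\ \|X_i\|_\infty\le 1\ \ \forall i\big\}.$$ For $\mathbf s\in\mathbb R^g$ write $\mathbf s.\mathcal D_{\square,g}(n)=\{(s_1X_1,\dots,s_gX_g):\mathbf X\in\mathcal D_{\square,g}(n)\}$, and write $\mathbf s.\mathcal D_{\square,g}\subseteq\mathcal D_{\mathbf B}$ if $\mathbf s.\mathcal D_{\square,g}(n)\subseteq\mathcal D_{\mathbf B}(n)$ for all $n$. Let $$\Delta_\square(g,d)=\big\{\mathbf s\in[0,1]^g:\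 \mathcal D_{\square,g}(1)\subseteq\mathcal D_{\mathbf B}(1)\Rightarrow \mathbf s.\mathcal D_{\square,g}\subseteq\mathcal D_{\mathbf B}\ \text{ for all } \mathbf B\in(\mathcal M_d^{\mathrm{sa}})^g\big\}$$ and $$\tau_*(d)=\min\big\{\mathbb E\,|\langle z,Bz\rangle| :\ B\in\mathcal M_d^{\mathrm{sa}},\ \|B\|_1=1\big\},$$ where $z\in\mathbb C^d$ is a standard complex Gaussian vector (independent coordinates whose real and imaginary parts are independent centred Gaussians of variance $1/2$). A (dichotomic) POVM is a pair $(E_1,E_2)$ of positive semidefinite $d\times d$ matrices with $E_1+E_2=I_d$. Pairs $(E_{a|x})_{a\in\{1,2\}}$, $x=1,\dots,g$, are compatible if there are finitely many positive semidefinite matrices $F_\lambda$ with $\sum_\lambda F_\lambda=I_d$ and conditional probabilities $p(a|x,\lambda)$ such that $E_{a|x}=\sum_\lambda p(a|x,\lambda)F_\lambda$ for all $a,x$. Let $\Gamma(g,d)$ be the set of all $\mathbf s\in[0,1]^g$ such that for all POVMs $(E_{a|x})_{a\in\{1,2\}}$, $x=1,\dots,g$, the POVMs $\big(s_xE_{a|x}+(1-s_x)I_d/2\big)_{a\in\{1,2\}}$,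 $x=1,\dots,g$, are compatible. **Theorem.** For all $g,d\in\mathbb N$ with $d\ge 2$ and every $\mathbf B\in(\mathcal M_d^{\mathrm{sa}})^g$, $$\mathcal D_{\square,g}(1)\subseteq\mathcal D_{\mathbf B}(1)\ \Longrightarrow\ \tau_*(d)\,\mathcal D_{\square,g}\subseteq\mathcal D_{\mathbf B}.$$ Thus $\tau_*(d)(1,\dots,1)\in\Delta_\square(g,d)$, and moreover $\tau_*(d)(1,\dots,1)\in\Gamma(g,d)$. -/

import Mathlib

open MeasureTheory ProbabilityTheory
open scoped ComplexOrder Kronecker Matrix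

namespace FreeSpec

noncomputable section

/-- Graded sets of `g`-tuples of complex square matrices: a set of `g`-tuples of `n × n` matrices
for each `n`. -/
abbrev MatrixSet (g : ℕ) : Type := ∀ n : ℕ, Set (Fin g → Matrix (Fin n) (Fin n) ℂ)

/-- Inclusion of graded sets: inclusion at all levels. -/
def Included {g : ℕ} (D D' : MatrixSet g) : Prop := ∀ n : ℕ, D n ⊆ D' n

/-- The entrywise scaling `s.D = {(s₁ X₁, …, s_g X_g) : X ∈ D}`. -/
def scale {g : ℕ} (s : Fin g → ℝ) (D : MatrixSet g) : MatrixSet g :=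
  fun n => (fun X i => s i • X i) '' D n

/-- The monic free spectrahedron `D_B`; its level `n` consists of the `g`-tuples of self-adjoint
`n × n` matrices `X` with `∑ i, B i ⊗ X i ≤ I_d ⊗ I_n`. -/
def spectrahedron {g d : ℕ} (B : Fin g → Matrix (Fin d) (Fin d) ℂ) : MatrixSet g :=
  fun n => {X | (∀ i, (X i).IsHermitian) ∧
    ((1 : Matrix (Fin d) (Fin d) ℂ) ⊗ₖ (1 : Matrix (Fin n) (Fin n) ℂ)
      - ∑ i, B i ⊗ₖ X i).PosSemidef}

/-- The operator norm of a matrix acting on a Euclidean space. -/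
def opNorm {n : ℕ} (X : Matrix (Fin n) (Fin n) ℂ) : ℝ :=
  ‖Matrix.toEuclideanCLM (𝕜 := ℂ) X‖

/-- The complex matrix cube: `g`-tuples of self-adjoint contractions. -/
def cube (g : ℕ) : MatrixSet g :=
  fun _ => {X | ∀ i, (X i).IsHermitian ∧ opNorm (X i) ≤ 1}

/-- The inclusion constants, for spectrahedra of `d × d` matrices, of a graded set `D`. -/
def inclusionConstants {g : ℕ} (D : MatrixSet g) (d : ℕ) : Set (Fin g → ℝ) :=
  {s | (∀ i, s i ∈ Set.Icc (0 : ℝ) 1) ∧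
    ∀ B : Fin g → Matrix (Fin d) (Fin d) ℂ, (∀ i, (B i).IsHermitian) →
      D 1 ⊆ spectrahedron B 1 → Included (scale s D) (spectrahedron B)}

/-- `Δ_□(g,d)`, the inclusion constant set of the complex matrix cube. -/
def cubeConstants (g d : ℕ) : Set (Fin g → ℝ) := inclusionConstants (cube g) d

/-- The Schatten `1`-norm: the sum of the singular values, that is, of the square roots of the
eigenvalues of `Bᴴ * B`. -/
def traceNorm {d : ℕ} (B : Matrix (Fin d) (Fin d) ℂ) : ℝ :=
  ∑ i, √((Matrix.isHermitian_conjTranspose_mul_self B).eigenvalues i)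

/-- The standard complex Gaussian distribution, the law of `x + i y` for independent real centred
Gaussians `x`, `y` of variance `1/2`. -/
def complexGaussian : Measure ℂ :=
  ((gaussianReal 0 (1 / 2)).prod (gaussianReal 0 (1 / 2))).map
    fun p : ℝ × ℝ => (p.1 : ℂ) + (p.2 : ℂ) * Complex.I

/-- The law of a standard complex Gaussian vector in `ℂ^d`, with independent standard complex
Gaussian coordinates. -/
def gaussianVector (d : ℕ) : Measure (Fin d → ℂ) := Measure.pi fun _ => complexGaussian

/-- `τ_*(d)`, the minimum of `𝔼 |⟨z, B z⟩|` over the self-adjoint `d × d` matrices `B` of Schatten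
`1`-norm one, where `z` is a standard complex Gaussian vector. -/
def tauStar (d : ℕ) : ℝ :=
  sInf {t : ℝ | ∃ B : Matrix (Fin d) (Fin d) ℂ, B.IsHermitian ∧ traceNorm B = 1 ∧
    t = ∫ z, ‖star z ⬝ᵥ (B *ᵥ z)‖ ∂(gaussianVector d)}

/-- Positive operator-valued measures with finite outcome set `ι`. -/
def IsPOVM {ι : Type*} [Fintype ι] {d : ℕ} (E : ι → Matrix (Fin d) (Fin d) ℂ) : Prop :=
  (∀ a, (E a).PosSemidef) ∧ ∑ a, E a = 1

/-- Compatibility (joint measurability) of a `g`-tuple of families `E x`, the `x`-th one with `k x`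
outcomes: they are classical post-processings, with conditional probabilities `p x a l`, of one
POVM `F` with finitely many outcomes. -/
def Compatible {g d : ℕ} {k : Fin g → ℕ}
    (E : ∀ x : Fin g, Fin (k x) → Matrix (Fin d) (Fin d) ℂ) : Prop :=
  ∃ (m : ℕ) (F : Fin m → Matrix (Fin d) (Fin d) ℂ) (p : ∀ x : Fin g, Fin (k x) → Fin m → ℝ),
    IsPOVM F ∧ (∀ x a l, 0 ≤ p x a l) ∧ (∀ x l, ∑ a, p x a l = 1) ∧
      ∀ x a, E x a = ∑ l, p x a l • F l

/-- The noisy version `s_x E_{a|x} + (1 - s_x) I_d / k_x` of the measurements `E`. -/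
def noisy {g d : ℕ} {k : Fin g → ℕ} (s : Fin g → ℝ)
    (E : ∀ x : Fin g, Fin (k x) → Matrix (Fin d) (Fin d) ℂ) :
    ∀ x : Fin g, Fin (k x) → Matrix (Fin d) (Fin d) ℂ :=
  fun x a => s x • E x a + ((1 - s x) / (k x : ℝ)) • (1 : Matrix (Fin d) (Fin d) ℂ)

/-- `Γ(g,d)`, the compatibility region of `g` dichotomic measurements in dimension `d`. -/
def compatibilityRegion (g d : ℕ) : Set (Fin g → ℝ) :=
  {s | (∀ x, s x ∈ Set.Icc (0 : ℝ) 1) ∧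
    ∀ E : Fin g → Fin 2 → Matrix (Fin d) (Fin d) ℂ, (∀ x, IsPOVM (E x)) →
      Compatible (k := fun _ => 2) (noisy (k := fun _ => 2) s E)}

end

end FreeSpec

/-!
The theorem rests on one trace inequality, `FreeSpec.tauStar_mul_sum_trace_le`. Let `Q x`, `Q₀` be
self-adjoint `d × d` matrices with `∑ x, |⟨w, Q x w⟩| ≤ ⟨w, Q₀ w⟩` for all vectors `w`. Taking for `w` a standard
complex Gaussian vector `z` and using `𝔼 ⟨z, Q₀ z⟩ = tr Q₀`, one gets
`∑ x, 𝔼 |⟨z, Q x z⟩| ≤ tr Q₀`. By definition of `τ_*(d)` the left-hand side is at least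
`τ_*(d) ∑ x, ‖Q x‖₁`, and by duality of the trace norm and the operator norm this is at least
`τ_*(d) ∑ x, tr (Q x A x)` for all self-adjoint contractions `A x`. Hence
`τ_*(d) ∑ x, tr (Q x A x) ≤ tr Q₀`.

For the inclusion of the scaled cube in `D_B`, the vectors of `ℂ^d ⊗ ℂ^n` are written as
vectorizations of `n × d` matrices `N`. The quadratic form of the pencil at such a vector is
`tr (Nᴴ N) - ∑ i, tr ((B i)ᵀ (Nᴴ X i N))`, where `-G ≤ Nᴴ X i N ≤ G` for the `d × d` Gram matrix
`G = Nᴴ N`. So everything happens in dimension `d`, whatever `n` is, and after congruence with a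
square root of (a perturbation of) `G` the trace inequality applies; this is
`FreeSpec.tauStar_mul_sum_trace_gram_le`. The hypothesis at level one of the cube says exactly that
`∑ i, |⟨w, B i w⟩| ≤ ⟨w, w⟩`.

For compatibility, dichotomic measurements with `A x = E x 0 - E x 1` are compatible after noise as
soon as there are positive semidefinite `F σ`, indexed by sign vectors `σ`, with `∑ σ, F σ = 1` and
`∑ σ, σ x • F σ = τ_*(d) A x`. The tuples `(∑ σ, F σ, (∑ σ, σ x • F σ) x)` with fixed total trace form
a compact convex set, so if the desired tuple is not of this form then a linear functional separates
it, and the coefficients of the functional contradict the trace inequality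
(`FreeSpec.exists_joint_measurement`).
-/

namespace FreeSpec

/-! ### Moments of the standard complex Gaussian vector -/

lemma measurable_complexGaussian_map :
    Measurable fun p : ℝ × ℝ => (p.1 : ℂ) + (p.2 : ℂ) * Complex.I := by
  fun_prop

instance : IsProbabilityMeasure complexGaussian :=
  Measure.isProbabilityMeasure_map measurable_complexGaussian_map.aemeasurable

instance (d : ℕ) : IsProbabilityMeasure (gaussianVector d) := by
  unfold gaussianVector; infer_instance

lemma memLp_complexGaussian : MemLp (fun z : ℂ => z) 2 complexGaussian := by
  have h := memLp_id_gaussianReal' (μ := 0) (v := 1 / 2) 2 (by norm_num)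
  have h1 : MemLp (fun p : ℝ × ℝ => (p.1 : ℂ)) 2
      ((gaussianReal 0 (1 / 2)).prod (gaussianReal 0 (1 / 2))) := (h.comp_fst _).ofReal
  have h2 : MemLp (fun p : ℝ × ℝ => (p.2 : ℂ)) 2
      ((gaussianReal 0 (1 / 2)).prod (gaussianReal 0 (1 / 2))) := (h.comp_snd _).ofReal
  unfold complexGaussian
  rw [memLp_map_measure_iff (by fun_prop) measurable_complexGaussian_map.aemeasurable]
  exact h1.add (h2.mul_const Complex.I)

lemma integral_complexGaussian : ∫ z, z ∂complexGaussian = 0 := by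
  have h := (memLp_id_gaussianReal' (μ := 0) (v := 1 / 2) 1 (by norm_num)).integrable le_rfl
  unfold complexGaussian
  rw [integral_map measurable_complexGaussian_map.aemeasurable (by fun_prop), integral_add,
    integral_mul_const, integral_fun_fst (fun x : ℝ => (x : ℂ)),
    integral_fun_snd (fun x : ℝ => (x : ℂ)), integral_complex_ofReal, integral_id_gaussianReal]
  · simp
  · exact (h.comp_fst _).ofReal
  · exact ((h.comp_snd _).ofReal).mul_const _

lemma integral_sq_gaussianReal (v : NNReal) : ∫ x, x ^ 2 ∂(gaussianReal 0 v) = v := by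
  have h := variance_id_gaussianReal (μ := 0) (v := v)
  rw [variance_of_integral_eq_zero aemeasurable_id (by simp)] at h
  simpa using h

lemma integral_normSq_complexGaussian : ∫ z, star z * z ∂complexGaussian = 1 := by
  have h := (memLp_id_gaussianReal' (μ := 0) (v := 1 / 2) 2 (by norm_num)).integrable_sq
  have h1 : Integrable (fun p : ℝ × ℝ => p.1 ^ 2)
      ((gaussianReal 0 (1 / 2)).prod (gaussianReal 0 (1 / 2))) := h.comp_fst _
  have h2 : Integrable (fun p : ℝ × ℝ => p.2 ^ 2)
      ((gaussianReal 0 (1 / 2)).prod (gaussianReal 0 (1 / 2))) := h.comp_snd _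
  unfold complexGaussian
  rw [integral_map measurable_complexGaussian_map.aemeasurable (by fun_prop)]
  have e : ∀ p : ℝ × ℝ, star ((p.1 : ℂ) + (p.2 : ℂ) * Complex.I) *
      ((p.1 : ℂ) + (p.2 : ℂ) * Complex.I) = ((p.1 ^ 2 + p.2 ^ 2 : ℝ) : ℂ) := by
    intro p
    apply Complex.ext <;> simp [-Complex.ofReal_pow] <;> ring
  simp_rw [e]
  rw [integral_complex_ofReal, integral_add h1 h2, integral_fun_fst (fun x : ℝ => x ^ 2),
    integral_fun_snd (fun x : ℝ => x ^ 2), integral_sq_gaussianReal]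
  norm_num

section Vector
variable {d : ℕ}

lemma measurePreserving_gaussianVector_eval (j : Fin d) :
    MeasurePreserving (fun z : Fin d → ℂ => z j) (gaussianVector d) complexGaussian :=
  measurePreserving_eval (fun _ => complexGaussian) j

lemma memLp_gaussianVector_coord (j : Fin d) :
    MemLp (fun z : Fin d → ℂ => z j) 2 (gaussianVector d) :=
  memLp_complexGaussian.comp_measurePreserving (measurePreserving_gaussianVector_eval j)

lemma integrable_gaussianVector_star_mul (j k : Fin d) :
    Integrable (fun z : Fin d → ℂ => star (z j) * z k) (gaussianVector d) :=
  (memLp_gaussianVector_coord j).star.integrable_mul (memLp_gaussianVector_coord k)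

/-- The coordinates of a standard complex Gaussian vector are orthonormal in `L²`. -/
lemma integral_gaussianVector_star_mul (j k : Fin d) :
    ∫ z, star (z j) * z k ∂(gaussianVector d) = if j = k then 1 else 0 := by
  split_ifs with h
  · subst h
    rw [← integral_normSq_complexGaussian,
      ← (measurePreserving_gaussianVector_eval j).map_eq,
      integral_map (measurable_pi_apply j).aemeasurable (by fun_prop)]
  · have hi : iIndepFun (fun (i : Fin d) (z : Fin d → ℂ) => z i) (gaussianVector d) :=
      iIndepFun_pi (X := fun _ z => z) fun _ => aemeasurable_id
    have hjk : IndepFun (fun z : Fin d → ℂ => star (z j)) (fun z => z k) (gaussianVector d) :=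
      (hi.indepFun h).comp (φ := star) (ψ := id) (by fun_prop) measurable_id
    rw [hjk.integral_fun_mul_eq_mul_integral
      (memLp_gaussianVector_coord j).star.aestronglyMeasurable
      (memLp_gaussianVector_coord k).aestronglyMeasurable]
    have : ∫ z, z k ∂(gaussianVector d) = 0 := by
      rw [← integral_complexGaussian, ← (measurePreserving_gaussianVector_eval k).map_eq,
        integral_map (measurable_pi_apply k).aemeasurable (by fun_prop)]
    rw [this, mul_zero]

lemma star_dotProduct_mulVec_eq_sum (A : Matrix (Fin d) (Fin d) ℂ) (z : Fin d → ℂ) :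
    star z ⬝ᵥ (A *ᵥ z) = ∑ j, ∑ k, A j k * (star (z j) * z k) := by
  simp only [dotProduct, Matrix.mulVec, Finset.mul_sum, Pi.star_apply]
  exact Finset.sum_congr rfl fun j _ => Finset.sum_congr rfl fun k _ => by ring

lemma integrable_quadraticForm (A : Matrix (Fin d) (Fin d) ℂ) :
    Integrable (fun z => star z ⬝ᵥ (A *ᵥ z)) (gaussianVector d) := by
  simp_rw [star_dotProduct_mulVec_eq_sum]
  exact integrable_finsetSum _ fun j _ => integrable_finsetSum _ fun k _ =>
    (integrable_gaussianVector_star_mul j k).const_mul (A j k)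

/-- The expectation of `⟨z, A z⟩` is the trace of `A`. -/
lemma integral_quadraticForm (A : Matrix (Fin d) (Fin d) ℂ) :
    ∫ z, star z ⬝ᵥ (A *ᵥ z) ∂(gaussianVector d) = A.trace := by
  have hi (j k : Fin d) := (integrable_gaussianVector_star_mul j k).const_mul (A j k)
  simp_rw [star_dotProduct_mulVec_eq_sum]
  rw [integral_finsetSum _ fun j _ => integrable_finsetSum _ fun k _ => hi j k]
  refine Finset.sum_congr rfl fun j _ => ?_
  rw [integral_finsetSum _ fun k _ => hi j k]
  simp_rw [integral_const_mul, integral_gaussianVector_star_mul]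
  simp

lemma integral_re_quadraticForm (A : Matrix (Fin d) (Fin d) ℂ) :
    ∫ z, (star z ⬝ᵥ (A *ᵥ z)).re ∂(gaussianVector d) = A.trace.re := by
  rw [← integral_quadraticForm A]
  exact integral_re (integrable_quadraticForm A)

end Vector

/-! ### The trace norm of a self-adjoint matrix and its duality with contractions -/

section TraceNorm
variable {d : ℕ}

/-- The trace norm of a unitarily diagonalized self-adjoint matrix is the `ℓ¹`-norm of the diagonal:
the eigenvalues of `Aᴴ * A` are, with multiplicity, the squares `μ j ^ 2`. -/
lemma traceNorm_of_diagonalization {A V : Matrix (Fin d) (Fin d) ℂ} {μ : Fin d → ℝ}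
    (hV : Vᴴ * V = 1) (hA : A = V * Matrix.diagonal (fun j => (μ j : ℂ)) * Vᴴ) :
    traceNorm A = ∑ j, |μ j| := by
  have hsq : Aᴴ * A = V * Matrix.diagonal (fun j => ((μ j ^ 2 : ℝ) : ℂ)) * Vᴴ := by
    have hD : (Matrix.diagonal fun j => (μ j : ℂ))ᴴ * Matrix.diagonal (fun j => (μ j : ℂ)) =
        Matrix.diagonal fun j => ((μ j ^ 2 : ℝ) : ℂ) := by
      rw [Matrix.diagonal_conjTranspose, Matrix.diagonal_mul_diagonal]
      congr 1; ext j; simp [sq]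
    rw [hA, ← hD]
    simp only [Matrix.conjTranspose_mul, Matrix.conjTranspose_conjTranspose]
    simp only [Matrix.mul_assoc]
    rw [← Matrix.mul_assoc Vᴴ V, hV, Matrix.one_mul]
  have hroots : Multiset.map (fun j => (((Matrix.isHermitian_conjTranspose_mul_self A).eigenvalues j
      : ℝ) : ℂ)) Finset.univ.val = Multiset.map (fun j => ((μ j ^ 2 : ℝ) : ℂ)) Finset.univ.val := by
    have h := (Matrix.isHermitian_conjTranspose_mul_self A).roots_charpoly_eq_eigenvalues
    refine Eq.trans h.symm ?_
    rw [hsq, Matrix.charpoly_mul_comm, ← Matrix.mul_assoc, hV, Matrix.one_mul,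
      Matrix.charpoly_diagonal, Polynomial.roots_prod _ _
        (Finset.prod_ne_zero_iff.2 fun _ _ => Polynomial.X_sub_C_ne_zero _)]
    simp only [Polynomial.roots_X_sub_C, Multiset.bind_singleton]
  have h := congrArg (fun s => (Multiset.map (fun z : ℂ => √z.re) s).sum) hroots
  simp only [Multiset.map_map, Function.comp_def, Complex.ofReal_re, Real.sqrt_sq_eq_abs] at h
  exact h

lemma exists_diagonalization {A : Matrix (Fin d) (Fin d) ℂ} (hA : A.IsHermitian) :
    ∃ (V : Matrix (Fin d) (Fin d) ℂ) (μ : Fin d → ℝ),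
      Vᴴ * V = 1 ∧ A = V * Matrix.diagonal (fun j => (μ j : ℂ)) * Vᴴ :=
  ⟨hA.eigenvectorUnitary, hA.eigenvalues, Unitary.coe_star_mul_self _, by
    have h := hA.spectral_theorem
    rwa [Unitary.conjStarAlgAut_apply] at h⟩

lemma traceNorm_nonneg (A : Matrix (Fin d) (Fin d) ℂ) : 0 ≤ traceNorm A :=
  Finset.sum_nonneg fun _ _ => Real.sqrt_nonneg _

lemma traceNorm_smul {A : Matrix (Fin d) (Fin d) ℂ} (hA : A.IsHermitian) {c : ℝ} (hc : 0 ≤ c) :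
    traceNorm (c • A) = c * traceNorm A := by
  obtain ⟨V, μ, hV, hVA⟩ := exists_diagonalization hA
  rw [traceNorm_of_diagonalization hV hVA, traceNorm_of_diagonalization (μ := c • μ) hV,
    Finset.mul_sum]
  · simp [abs_mul, abs_of_nonneg hc]
  · have : (Matrix.diagonal fun j => (((c • μ) j : ℝ) : ℂ)) =
        c • Matrix.diagonal fun j => (μ j : ℂ) := by
      rw [← Matrix.diagonal_smul]; congr 1; ext j; simp
    rw [this, Matrix.mul_smul, Matrix.smul_mul, ← hVA]

/-- Duality of the trace norm and the operator norm, with the contraction `Z` given by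
`-1 ≤ Z ≤ 1`. -/
lemma re_trace_mul_le_traceNorm {A Z : Matrix (Fin d) (Fin d) ℂ} (hA : A.IsHermitian)
    (h1 : (1 - Z).PosSemidef) (h2 : (1 + Z).PosSemidef) :
    (A * Z).trace.re ≤ traceNorm A := by
  obtain ⟨V, μ, hV, hVA⟩ := exists_diagonalization hA
  rw [traceNorm_of_diagonalization hV hVA]
  have htr : (A * Z).trace = ∑ j, (μ j : ℂ) * (Vᴴ * Z * V) j j := by
    rw [hVA, Matrix.mul_assoc, Matrix.mul_assoc, Matrix.trace_mul_comm, Matrix.mul_assoc,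
      Matrix.trace]
    simp [Matrix.diagonal_mul]
  have hle (j : Fin d) : |((Vᴴ * Z * V) j j).re| ≤ 1 := by
    have e1 := (h1.conjTranspose_mul_mul_same V).diag_nonneg (i := j)
    have e2 := (h2.conjTranspose_mul_mul_same V).diag_nonneg (i := j)
    rw [Matrix.mul_sub, Matrix.sub_mul, Matrix.mul_one, hV, Matrix.sub_apply, Matrix.one_apply_eq]
      at e1
    rw [Matrix.mul_add, Matrix.add_mul, Matrix.mul_one, hV, Matrix.add_apply, Matrix.one_apply_eq]
      at e2
    have e1 := (Complex.le_def.1 e1).1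
    have e2 := (Complex.le_def.1 e2).1
    simp only [Complex.zero_re, Complex.sub_re, Complex.add_re, Complex.one_re] at e1 e2
    exact abs_le.2 ⟨by linarith, by linarith⟩
  rw [htr, Complex.re_sum]
  refine Finset.sum_le_sum fun j _ => ?_
  rw [Complex.re_ofReal_mul]
  refine (le_abs_self _).trans ?_
  rw [abs_mul]
  exact mul_le_of_le_one_right (abs_nonneg _) (hle j)

end TraceNorm

/-! ### The constant `τ_*(d)` and the fundamental trace inequality -/

section TauStar
variable {d : ℕ}

lemma bddBelow_tauStar (d : ℕ) :
    BddBelow {t : ℝ | ∃ B : Matrix (Fin d) (Fin d) ℂ, B.IsHermitian ∧ traceNorm B = 1 ∧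
      t = ∫ z, ‖star z ⬝ᵥ (B *ᵥ z)‖ ∂(gaussianVector d)} := by
  refine ⟨0, ?_⟩
  rintro t ⟨B, -, -, rfl⟩
  exact integral_nonneg fun _ => norm_nonneg _

lemma tauStar_nonneg (d : ℕ) : 0 ≤ tauStar d := by
  refine Real.sInf_nonneg ?_
  rintro t ⟨B, -, -, rfl⟩
  exact integral_nonneg fun _ => norm_nonneg _

/-- The rank one projection onto a coordinate axis is admissible in the definition of `τ_*(d)`, with
value `𝔼 |z₀|² = 1`. -/
lemma tauStar_le_one (hd : 0 < d) : tauStar d ≤ 1 := by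
  refine csInf_le (bddBelow_tauStar d)
    ⟨Matrix.diagonal fun j => ((Pi.single (⟨0, hd⟩ : Fin d) (1 : ℝ) : Fin d → ℝ) j : ℂ), ?_, ?_, ?_⟩
  · rw [Matrix.IsHermitian, Matrix.diagonal_conjTranspose]
    congr 1; ext j; simp
  · rw [traceNorm_of_diagonalization (V := 1)
      (μ := (Pi.single (⟨0, hd⟩ : Fin d) (1 : ℝ) : Fin d → ℝ)) (by simp) (by simp)]
    rw [Finset.sum_eq_single ⟨0, hd⟩ (fun j _ hj => by simp [hj]) (by simp)]
    simp
  · set P : Matrix (Fin d) (Fin d) ℂ :=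
      Matrix.diagonal fun j => ((Pi.single (⟨0, hd⟩ : Fin d) (1 : ℝ) : Fin d → ℝ) j : ℂ) with hP
    have hpos : P.PosSemidef := Matrix.PosSemidef.diagonal fun j => by
      simp only [Pi.zero_apply, Complex.zero_le_real]
      exact (Pi.single_nonneg.2 zero_le_one : (0 : Fin d → ℝ) ≤ Pi.single _ _) j
    have e (z : Fin d → ℂ) : ‖star z ⬝ᵥ (P *ᵥ z)‖ = (star z ⬝ᵥ (P *ᵥ z)).re :=
      (Complex.re_eq_norm.2 (hpos.dotProduct_mulVec_nonneg z)).symm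
    simp_rw [e]
    rw [integral_re_quadraticForm, hP,
      Matrix.trace_diagonal, Finset.sum_eq_single ⟨0, hd⟩ (fun j _ hj => by simp [hj]) (by simp)]
    simp

/-- The definition of `τ_*(d)`, made homogeneous in the matrix. -/
lemma tauStar_mul_traceNorm_le {A : Matrix (Fin d) (Fin d) ℂ} (hA : A.IsHermitian) :
    tauStar d * traceNorm A ≤ ∫ z, ‖star z ⬝ᵥ (A *ᵥ z)‖ ∂(gaussianVector d) := by
  rcases (traceNorm_nonneg A).eq_or_lt with h0 | h0
  · rw [← h0, mul_zero]
    exact integral_nonneg fun _ => norm_nonneg _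
  · have hle : tauStar d ≤ (traceNorm A)⁻¹ * ∫ z, ‖star z ⬝ᵥ (A *ᵥ z)‖ ∂(gaussianVector d) := by
      refine csInf_le (bddBelow_tauStar d) ⟨(traceNorm A)⁻¹ • A, ?_, ?_, ?_⟩
      · rw [Matrix.IsHermitian, Matrix.conjTranspose_smul, hA.eq, star_trivial]
      · rw [traceNorm_smul hA (inv_nonneg.2 h0.le), inv_mul_cancel₀ h0.ne']
      · rw [← integral_const_mul]
        congr 1; ext z
        rw [Matrix.smul_mulVec, dotProduct_smul, norm_smul, Real.norm_of_nonneg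
          (inv_nonneg.2 h0.le)]
    rwa [inv_mul_eq_div, le_div_iff₀ h0] at hle

/-- If the quadratic forms of self-adjoint matrices `Q x` satisfy `∑ x, |⟨w, Q x w⟩| ≤ ⟨w, Q₀ w⟩`
for all vectors `w`, then `τ_*(d) ∑ x, tr (Q x A x) ≤ tr Q₀` for all self-adjoint contractions
`A x`. The hypothesis is integrated against the Gaussian vector. -/
lemma tauStar_mul_sum_trace_le {ι : Type*} [Fintype ι] {Q₀ : Matrix (Fin d) (Fin d) ℂ}
    {Q A : ι → Matrix (Fin d) (Fin d) ℂ} (hQ : ∀ x, (Q x).IsHermitian)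
    (h : ∀ w : Fin d → ℂ, ∑ x, ‖star w ⬝ᵥ (Q x *ᵥ w)‖ ≤ (star w ⬝ᵥ (Q₀ *ᵥ w)).re)
    (h1 : ∀ x, (1 - A x).PosSemidef) (h2 : ∀ x, (1 + A x).PosSemidef) :
    tauStar d * ∑ x, (Q x * A x).trace.re ≤ Q₀.trace.re := by
  calc tauStar d * ∑ x, (Q x * A x).trace.re
      ≤ tauStar d * ∑ x, traceNorm (Q x) := by
        gcongr with x
        · exact tauStar_nonneg d
        · exact re_trace_mul_le_traceNorm (hQ x) (h1 x) (h2 x)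
    _ = ∑ x, tauStar d * traceNorm (Q x) := Finset.mul_sum ..
    _ ≤ ∑ x, ∫ z, ‖star z ⬝ᵥ (Q x *ᵥ z)‖ ∂(gaussianVector d) :=
        Finset.sum_le_sum fun x _ => tauStar_mul_traceNorm_le (hQ x)
    _ = ∫ z, ∑ x, ‖star z ⬝ᵥ (Q x *ᵥ z)‖ ∂(gaussianVector d) :=
        (integral_finsetSum _ fun x _ => (integrable_quadraticForm (Q x)).norm).symm
    _ ≤ ∫ z, (star z ⬝ᵥ (Q₀ *ᵥ z)).re ∂(gaussianVector d) :=
        integral_mono (integrable_finsetSum _ fun x _ => (integrable_quadraticForm (Q x)).norm)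
          (integrable_quadraticForm Q₀).re h
    _ = Q₀.trace.re := integral_re_quadraticForm Q₀

end TauStar

/-! ### Signed sums of quadratic forms -/

section Signs
variable {d : ℕ}

/-- The sign `±1` encoded by a Boolean, with `true` for `+1`. -/
def boolSign (b : Bool) : ℝ := if b then 1 else -1

lemma abs_boolSign (b : Bool) : |boolSign b| = 1 := by
  cases b <;> simp [boolSign]

lemma exists_boolSign_mul_eq_abs (r : ℝ) : ∃ b, boolSign b * r = |r| := by
  rcases le_total 0 r with h | h
  · exact ⟨true, by simp [boolSign, abs_of_nonneg h]⟩
  · exact ⟨false, by simp [boolSign, abs_of_nonpos h]⟩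

lemma norm_quadraticForm {A : Matrix (Fin d) (Fin d) ℂ} (hA : A.IsHermitian) (w : Fin d → ℂ) :
    ‖star w ⬝ᵥ (A *ᵥ w)‖ = |(star w ⬝ᵥ (A *ᵥ w)).re| :=
  (Complex.abs_re_eq_norm.2 (hA.im_star_dotProduct_mulVec_self w)).symm

lemma sum_norm_quadraticForm_le {ι : Type*} [Fintype ι] {Q : ι → Matrix (Fin d) (Fin d) ℂ}
    (hQ : ∀ x, (Q x).IsHermitian) (w : Fin d → ℂ) (r : ℝ)
    (h : ∀ σ : ι → Bool, ∑ x, boolSign (σ x) * (star w ⬝ᵥ (Q x *ᵥ w)).re ≤ r) :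
    ∑ x, ‖star w ⬝ᵥ (Q x *ᵥ w)‖ ≤ r := by
  choose σ hσ using fun x => exists_boolSign_mul_eq_abs (star w ⬝ᵥ (Q x *ᵥ w)).re
  simpa only [norm_quadraticForm (hQ _), ← hσ] using h σ

end Signs

/-! ### Inclusion of the scaled matrix cube -/

section Gram
variable {d : ℕ}

lemma exists_isHermitian_mul_self_eq {P : Matrix (Fin d) (Fin d) ℂ} (hP : P.PosSemidef) :
    ∃ C : Matrix (Fin d) (Fin d) ℂ, C.IsHermitian ∧ C * C = P := by
  open scoped MatrixOrder in
  exact ⟨CFC.sqrt P, (Matrix.nonneg_iff_posSemidef.1 (CFC.sqrt_nonneg P)).1, CFC.sqrt_mul_sqrt_self P hP.nonneg⟩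

/-- The trace inequality for `-G ≤ Y x ≤ G` in place of `-1 ≤ A x ≤ 1`, for quadratic forms
dominated by the norm. For invertible `G = C * C` it is the inequality for the forms `C * B x * C`
and the contractions `C⁻¹ * Y x * C⁻¹`; the general case follows by perturbing `G`. -/
lemma tauStar_mul_sum_trace_gram_le {ι : Type*} [Fintype ι] {G : Matrix (Fin d) (Fin d) ℂ}
    {B Y : ι → Matrix (Fin d) (Fin d) ℂ} (hB : ∀ x, (B x).IsHermitian)
    (h : ∀ w : Fin d → ℂ, ∑ x, ‖star w ⬝ᵥ (B x *ᵥ w)‖ ≤ (star w ⬝ᵥ w).re)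
    (hG : G.PosSemidef) (h1 : ∀ x, (G - Y x).PosSemidef) (h2 : ∀ x, (G + Y x).PosSemidef) :
    tauStar d * ∑ x, (B x * Y x).trace.re ≤ G.trace.re := by
  have key (ε : ℝ) (hε : 0 < ε) :
      tauStar d * ∑ x, (B x * Y x).trace.re ≤ G.trace.re + ε * d := by
    have hεd : ((ε : ℂ) • (1 : Matrix (Fin d) (Fin d) ℂ)).PosDef :=
      Matrix.PosDef.one.smul (by exact_mod_cast hε)
    have hpd : (G + (ε : ℂ) • 1).PosDef := Matrix.PosDef.posSemidef_add hG hεd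
    obtain ⟨C, hC, hCC⟩ := exists_isHermitian_mul_self_eq hpd.posSemidef
    have hu : IsUnit C.det := by
      have := hpd.isUnit.map Matrix.detMonoidHom
      rw [← hCC, map_mul] at this
      exact isUnit_of_mul_isUnit_left this
    have hCi : C⁻¹.IsHermitian := hC.inv
    have hone : C⁻¹ * (G + (ε : ℂ) • 1) * C⁻¹ = 1 := by
      rw [← hCC, ← Matrix.mul_assoc, Matrix.nonsing_inv_mul _ hu, Matrix.one_mul,
        Matrix.mul_nonsing_inv _ hu]
    have hQ (x : ι) : (C * B x * C).IsHermitian := by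
      simpa only [hC.eq] using Matrix.isHermitian_conjTranspose_mul_mul C (hB x)
    have hform (M : Matrix (Fin d) (Fin d) ℂ) (w : Fin d → ℂ) :
        star w ⬝ᵥ ((C * M * C) *ᵥ w) = star (C *ᵥ w) ⬝ᵥ (M *ᵥ (C *ᵥ w)) := by
      rw [Matrix.star_mulVec, hC.eq, ← Matrix.dotProduct_mulVec, Matrix.mulVec_mulVec,
        Matrix.mulVec_mulVec]
    have hdom (w : Fin d → ℂ) : ∑ x, ‖star w ⬝ᵥ ((C * B x * C) *ᵥ w)‖ ≤
        (star w ⬝ᵥ ((C * 1 * C) *ᵥ w)).re := by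
      simpa only [hform, Matrix.one_mulVec] using h (C *ᵥ w)
    have := tauStar_mul_sum_trace_le (Q₀ := C * 1 * C) (Q := fun x => C * B x * C)
      (A := fun x => C⁻¹ * Y x * C⁻¹) hQ hdom
      (fun x => by
        have hp := ((h1 x).add hεd.posSemidef).conjTranspose_mul_mul_same C⁻¹
        rw [hCi.eq] at hp
        rw [← hone, ← Matrix.sub_mul, ← Matrix.mul_sub]
        convert hp using 3
        abel)
      (fun x => by
        have hp := ((h2 x).add hεd.posSemidef).conjTranspose_mul_mul_same C⁻¹
        rw [hCi.eq] at hp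
        rw [← hone, ← Matrix.add_mul, ← Matrix.mul_add]
        convert hp using 3
        abel)
    have htr (x : ι) : (C * B x * C * (C⁻¹ * Y x * C⁻¹)).trace = (B x * Y x).trace := by
      have : C * B x * C * (C⁻¹ * Y x * C⁻¹) = C * (B x * Y x) * C⁻¹ := by
        simp only [Matrix.mul_assoc]
        rw [Matrix.mul_nonsing_inv_cancel_left _ _ hu]
      rw [this, Matrix.trace_mul_comm, ← Matrix.mul_assoc, Matrix.nonsing_inv_mul _ hu,
        Matrix.one_mul]
    simp only [htr, Matrix.mul_one, hCC] at this
    simpa using this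
  refine le_of_forall_pos_le_add fun δ hδ => (key (δ / (d + 1)) (by positivity)).trans ?_
  gcongr
  rw [div_mul_eq_mul_div, div_le_iff₀ (by positivity)]
  nlinarith

end Gram

section Cube
variable {g d : ℕ}

/-- The quadratic form of a linear pencil at a vectorized matrix. -/
lemma quadraticForm_pencil {n : ℕ} (B : Fin g → Matrix (Fin d) (Fin d) ℂ)
    (X : Fin g → Matrix (Fin n) (Fin n) ℂ) (N : Matrix (Fin n) (Fin d) ℂ) :
    star N.vec ⬝ᵥ (((1 : Matrix (Fin d) (Fin d) ℂ) ⊗ₖ (1 : Matrix (Fin n) (Fin n) ℂ)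
      - ∑ i, B i ⊗ₖ X i) *ᵥ N.vec) =
      (Nᴴ * N).trace - ∑ i, ((B i)ᵀ * (Nᴴ * X i * N)).trace := by
  rw [Matrix.sub_mulVec, Matrix.sum_mulVec, dotProduct_sub, dotProduct_sum]
  simp only [Matrix.kronecker_mulVec_vec, Matrix.star_vec_dotProduct_vec]
  congr 1
  · simp
  · refine Finset.sum_congr rfl fun i _ => ?_
    rw [Matrix.trace_mul_comm (B i)ᵀ]
    simp only [Matrix.mul_assoc]

lemma opNorm_smul_one_le {n : ℕ} (c : ℂ) (hc : ‖c‖ ≤ 1) :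
    opNorm (c • (1 : Matrix (Fin n) (Fin n) ℂ)) ≤ 1 := by
  rw [opNorm, map_smul, map_one, norm_smul]
  exact mul_le_one₀ hc (norm_nonneg _) ContinuousLinearMap.norm_id_le

/-- The first level of the inclusion, expressed by quadratic forms. -/
lemma sum_norm_quadraticForm_le_of_cube_subset {B : Fin g → Matrix (Fin d) (Fin d) ℂ}
    (hB : ∀ i, (B i).IsHermitian) (h : cube g 1 ⊆ spectrahedron B 1) (w : Fin d → ℂ) :
    ∑ i, ‖star w ⬝ᵥ (B i *ᵥ w)‖ ≤ (star w ⬝ᵥ w).re := by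
  refine sum_norm_quadraticForm_le hB w _ fun σ => ?_
  have hX := h (a := fun i => (boolSign (σ i) : ℂ) • 1) fun i =>
    ⟨by simp [Matrix.IsHermitian, Matrix.conjTranspose_smul],
      opNorm_smul_one_le _ (by rw [Complex.norm_real, Real.norm_eq_abs, abs_boolSign])⟩
  have hpos := hX.2.dotProduct_mulVec_nonneg (Matrix.replicateRow (Fin 1) w).vec
  rw [quadraticForm_pencil] at hpos
  have e1 : ((Matrix.replicateRow (Fin 1) w)ᴴ * Matrix.replicateRow (Fin 1) w).trace =
      star w ⬝ᵥ w := by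
    simp [Matrix.trace, Matrix.mul_apply, dotProduct]
  have e2 (i : Fin g) : ((B i)ᵀ * ((Matrix.replicateRow (Fin 1) w)ᴴ *
      ((boolSign (σ i) : ℂ) • (1 : Matrix (Fin 1) (Fin 1) ℂ)) *
        Matrix.replicateRow (Fin 1) w)).trace =
      (boolSign (σ i) : ℂ) * (star w ⬝ᵥ (B i *ᵥ w)) := by
    rw [star_dotProduct_mulVec_eq_sum]
    simp only [Matrix.trace, Matrix.mul_smul, Matrix.smul_mul, Matrix.mul_one, Matrix.diag_apply,
      Matrix.smul_apply, smul_eq_mul, ← Finset.mul_sum, Matrix.mul_apply]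
    rw [Finset.sum_comm]
    simp
  rw [e1] at hpos
  simp only [e2] at hpos
  have hre := (Complex.le_def.1 hpos).1
  simp only [Complex.sub_re, Complex.re_sum, Complex.re_ofReal_mul, Complex.zero_re] at hre
  linarith

lemma posSemidef_one_sub_of_opNorm_le {n : ℕ} {X : Matrix (Fin n) (Fin n) ℂ} (hX : X.IsHermitian)
    (h : opNorm X ≤ 1) : (1 - X).PosSemidef := by
  refine .of_dotProduct_mulVec_nonneg (Matrix.isHermitian_one.sub hX) fun w => ?_
  have him : (star w ⬝ᵥ ((1 - X) *ᵥ w)).im = 0 :=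
    (Matrix.isHermitian_one.sub hX).im_star_dotProduct_mulVec_self w
  refine Complex.le_def.2 ⟨?_, him.symm⟩
  set v : EuclideanSpace ℂ (Fin n) := WithLp.toLp 2 w
  have e1 : star w ⬝ᵥ w = inner ℂ v v := by
    rw [EuclideanSpace.inner_eq_star_dotProduct, dotProduct_comm]
  have e2 : star w ⬝ᵥ (X *ᵥ w) = inner ℂ v (Matrix.toEuclideanCLM (𝕜 := ℂ) X v) := by
    rw [EuclideanSpace.inner_eq_star_dotProduct, dotProduct_comm]
    rfl
  have hle : (inner ℂ v (Matrix.toEuclideanCLM (𝕜 := ℂ) X v)).re ≤ ‖v‖ ^ 2 := by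
    calc (inner ℂ v (Matrix.toEuclideanCLM (𝕜 := ℂ) X v)).re
        ≤ ‖v‖ * ‖Matrix.toEuclideanCLM (𝕜 := ℂ) X v‖ := re_inner_le_norm (𝕜 := ℂ) _ _
      _ ≤ ‖v‖ * (1 * ‖v‖) := by
        gcongr
        exact (ContinuousLinearMap.le_opNorm _ _).trans (by gcongr; exact h)
      _ = ‖v‖ ^ 2 := by ring
  have hself : (inner ℂ v v).re = ‖v‖ ^ 2 := inner_self_eq_norm_sq (𝕜 := ℂ) v
  rw [Matrix.sub_mulVec, Matrix.one_mulVec, dotProduct_sub, e1, e2, Complex.sub_re, hself,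
    Complex.zero_re]
  linarith

lemma opNorm_neg {n : ℕ} (X : Matrix (Fin n) (Fin n) ℂ) : opNorm (-X) = opNorm X := by
  rw [opNorm, map_neg, norm_neg, opNorm]

lemma posSemidef_one_add_of_opNorm_le {n : ℕ} {X : Matrix (Fin n) (Fin n) ℂ} (hX : X.IsHermitian)
    (h : opNorm X ≤ 1) : (1 + X).PosSemidef := by
  rw [← sub_neg_eq_add]
  exact posSemidef_one_sub_of_opNorm_le hX.neg (by rwa [opNorm_neg])

lemma quadraticForm_transpose (A : Matrix (Fin d) (Fin d) ℂ) (w : Fin d → ℂ) :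
    star w ⬝ᵥ (Aᵀ *ᵥ w) = star (star w) ⬝ᵥ (A *ᵥ star w) := by
  rw [star_star, Matrix.mulVec_transpose, dotProduct_comm, ← Matrix.dotProduct_mulVec]

/-- Inclusion at level one implies inclusion of the scaled cube at all levels. -/
lemma included_scale_cube {B : Fin g → Matrix (Fin d) (Fin d) ℂ}
    (hB : ∀ i, (B i).IsHermitian) (h : cube g 1 ⊆ spectrahedron B 1) :
    Included (scale (fun _ => tauStar d) (cube g)) (spectrahedron B) := by
  rintro n _ ⟨X, hX, rfl⟩
  have hXs (i : Fin g) : (tauStar d • X i).IsHermitian := by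
    rw [Matrix.IsHermitian, Matrix.conjTranspose_smul, (hX i).1.eq, star_trivial]
  refine ⟨hXs, ?_⟩
  have hherm : ((1 : Matrix (Fin d) (Fin d) ℂ) ⊗ₖ (1 : Matrix (Fin n) (Fin n) ℂ)
      - ∑ i, B i ⊗ₖ (tauStar d • X i)).IsHermitian := by
    rw [Matrix.IsHermitian, Matrix.conjTranspose_sub, Matrix.conjTranspose_sum]
    simp only [Matrix.conjTranspose_kronecker, Matrix.conjTranspose_one, (hB _).eq, (hXs _).eq]
  refine .of_dotProduct_mulVec_nonneg hherm fun ξ => ?_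
  refine Complex.le_def.2 ⟨?_, (hherm.im_star_dotProduct_mulVec_self ξ).symm⟩
  obtain ⟨N, rfl⟩ := Matrix.vec_bijective.2 ξ
  have hpos1 (i : Fin g) : (Nᴴ * N - Nᴴ * X i * N).PosSemidef := by
    have := (posSemidef_one_sub_of_opNorm_le (hX i).1 (hX i).2).conjTranspose_mul_mul_same N
    rwa [Matrix.mul_sub, Matrix.sub_mul, Matrix.mul_one] at this
  have hpos2 (i : Fin g) : (Nᴴ * N + Nᴴ * X i * N).PosSemidef := by
    have := (posSemidef_one_add_of_opNorm_le (hX i).1 (hX i).2).conjTranspose_mul_mul_same N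
    rwa [Matrix.mul_add, Matrix.add_mul, Matrix.mul_one] at this
  have key := tauStar_mul_sum_trace_gram_le (B := fun i => (B i)ᵀ)
    (Y := fun i => Nᴴ * X i * N) (fun i => (hB i).transpose)
    (fun w => by
      simp only [quadraticForm_transpose]
      refine (sum_norm_quadraticForm_le_of_cube_subset hB h (star w)).trans_eq ?_
      rw [star_star, dotProduct_comm])
    (Matrix.posSemidef_conjTranspose_mul_self N) hpos1 hpos2
  rw [quadraticForm_pencil]
  simp only [Matrix.mul_smul, Matrix.smul_mul, Matrix.trace_smul, Complex.sub_re, Complex.re_sum,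
    Complex.smul_re, smul_eq_mul, ← Finset.mul_sum, Complex.zero_re]
  linarith

end Cube

/-! ### Normalized signed sums of positive semidefinite matrices -/

section SignedSums
variable {g d : ℕ}

/-- The signs by which the matrix with index `σ` enters a signed sum: `+1` at `none`, and the
`x`-th sign of `σ` at `some x`. -/
def optionSign (σ : Fin g → Bool) : Option (Fin g) → ℝ
  | none => 1
  | some x => boolSign (σ x)

/-- The tuples `(∑ σ, F σ, (∑ σ, σ x • F σ) x)` for positive semidefinite `F σ`, indexed by the sign
vectors `σ` and of total trace one. Plain functions stand for matrices, because these carry the norm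
needed for separation arguments. -/
def signedSums (g d : ℕ) : Set (Option (Fin g) → Fin d → Fin d → ℂ) :=
  {Y | ∃ F : (Fin g → Bool) → Matrix (Fin d) (Fin d) ℂ, (∀ σ, (F σ).PosSemidef) ∧
    ∑ σ, (F σ).trace.re = 1 ∧ ∀ o j k, Y o j k = ∑ σ, (optionSign σ o : ℂ) * F σ j k}

lemma convex_signedSums : Convex ℝ (signedSums g d) := by
  rintro Y ⟨F, hF, hFt, hY⟩ Y' ⟨F', hF', hFt', hY'⟩ a b ha hb hab
  refine ⟨fun σ => a • F σ + b • F' σ, fun σ => ((hF σ).smul ha).add ((hF' σ).smul hb), ?_, ?_⟩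
  · simp only [Matrix.trace_add, Matrix.trace_smul, Complex.add_re, Complex.smul_re, smul_eq_mul,
      Finset.sum_add_distrib, ← Finset.mul_sum, hFt, hFt', mul_one, hab]
  · intro o j k
    simp only [Pi.add_apply, Pi.smul_apply, hY, hY', Matrix.add_apply, Matrix.smul_apply,
      Finset.smul_sum, ← Finset.sum_add_distrib, Complex.real_smul]
    exact Finset.sum_congr rfl fun σ _ => by ring

lemma re_trace_conjTranspose_mul_self (W : Matrix (Fin d) (Fin d) ℂ) :
    (Wᴴ * W).trace.re = ∑ j, ∑ k, ‖W j k‖ ^ 2 := by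
  rw [Finset.sum_comm]
  simp [Matrix.trace, Matrix.mul_apply, Complex.sq_norm, Complex.normSq_apply]

/-- The set of families of square roots `W σ` of the summands is a sphere. -/
lemma isCompact_signedSums : IsCompact (signedSums g d) := by
  let K : Set ((Fin g → Bool) → Fin d → Fin d → ℂ) := {W | ∑ σ, ∑ j, ∑ k, ‖W σ j k‖ ^ 2 = 1}
  have hK : IsCompact K := by
    refine Metric.isCompact_of_isClosed_isBounded (isClosed_eq (by fun_prop) continuous_const)
      ((Metric.isBounded_closedBall (x := 0) (r := 1)).subset fun W hW => ?_)
    rw [mem_closedBall_zero_iff]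
    refine (pi_norm_le_iff_of_nonneg zero_le_one).2 fun σ =>
      (pi_norm_le_iff_of_nonneg zero_le_one).2 fun j =>
      (pi_norm_le_iff_of_nonneg zero_le_one).2 fun k => ?_
    have h1 : ‖W σ j k‖ ^ 2 ≤ ∑ k, ‖W σ j k‖ ^ 2 :=
      Finset.single_le_sum (f := fun k => ‖W σ j k‖ ^ 2) (fun _ _ => by positivity)
        (Finset.mem_univ k)
    have h2 : ∑ k, ‖W σ j k‖ ^ 2 ≤ ∑ j, ∑ k, ‖W σ j k‖ ^ 2 :=
      Finset.single_le_sum (f := fun j => ∑ k, ‖W σ j k‖ ^ 2) (fun _ _ => by positivity)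
        (Finset.mem_univ j)
    have h3 : ∑ j, ∑ k, ‖W σ j k‖ ^ 2 ≤ ∑ σ, ∑ j, ∑ k, ‖W σ j k‖ ^ 2 :=
      Finset.single_le_sum (f := fun σ => ∑ j, ∑ k, ‖W σ j k‖ ^ 2) (fun _ _ => by positivity)
        (Finset.mem_univ σ)
    have h4 : ∑ σ, ∑ j, ∑ k, ‖W σ j k‖ ^ 2 = 1 := hW
    exact (sq_le_one_iff₀ (norm_nonneg _)).1 (by linarith)
  let Φ : ((Fin g → Bool) → Fin d → Fin d → ℂ) → Option (Fin g) → Fin d → Fin d → ℂ :=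
    fun W o j k => ∑ σ, (optionSign σ o : ℂ) * ∑ l, star (W σ l j) * W σ l k
  have hΦ : Continuous Φ := by fun_prop
  convert! hK.image hΦ using 1
  ext Y
  constructor
  · rintro ⟨F, hF, hFt, hY⟩
    choose W hW hWF using fun σ => exists_isHermitian_mul_self_eq (hF σ)
    have hWF' (σ : Fin g → Bool) : F σ = (W σ)ᴴ * W σ := by rw [(hW σ).eq, hWF]
    refine ⟨W, ?_, ?_⟩
    · simp only [hWF', re_trace_conjTranspose_mul_self] at hFt
      exact hFt
    · ext o j k
      rw [hY]
      simp only [hWF', Matrix.mul_apply, Matrix.conjTranspose_apply, Φ]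
  · rintro ⟨W, hW, rfl⟩
    refine ⟨fun σ => (Matrix.of (W σ))ᴴ * Matrix.of (W σ),
      fun σ => Matrix.posSemidef_conjTranspose_mul_self _, ?_, fun o j k => ?_⟩
    · simp only [re_trace_conjTranspose_mul_self]
      exact hW
    · simp only [Φ, Matrix.mul_apply, Matrix.conjTranspose_apply, Matrix.of_apply]

/-- The real part of a complex linear functional on tuples of matrices, evaluated at self-adjoint
tuples, is the trace pairing with a self-adjoint tuple. -/
lemma exists_isHermitian_trace_repr {ι : Type*} [Fintype ι] [DecidableEq ι]
    (f : (ι → Fin d → Fin d → ℂ) →ₗ[ℂ] ℂ) :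
    ∃ R : ι → Matrix (Fin d) (Fin d) ℂ, (∀ o, (R o).IsHermitian) ∧
      ∀ Y : ι → Matrix (Fin d) (Fin d) ℂ, (∀ o, (Y o).IsHermitian) →
        (f fun o j k => Y o j k).re = ∑ o, (R o * Y o).trace.re := by
  let M : ι → Matrix (Fin d) (Fin d) ℂ := fun o => Matrix.of fun k j =>
    f (Pi.single o (Pi.single j (Pi.single k 1)))
  have hM (Y : ι → Matrix (Fin d) (Fin d) ℂ) :
      f (fun o j k => Y o j k) = ∑ o, (M o * Y o).trace := by
    have hY : (fun o j k => Y o j k) = ∑ o, ∑ k, ∑ j,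
        Y o j k • (Pi.single o (Pi.single j (Pi.single k 1)) : ι → Fin d → Fin d → ℂ) := by
      ext o j k
      simp only [Finset.sum_apply, Pi.smul_apply, smul_eq_mul]
      rw [Finset.sum_eq_single o, Finset.sum_eq_single k, Finset.sum_eq_single j]
      · simp
      · intro j' _ hj'; simp [hj'.symm]
      · simp
      · intro k' _ hk'
        refine Finset.sum_eq_zero fun j' _ => ?_
        rcases eq_or_ne j j' with rfl | hj
        · simp [hk'.symm]
        · simp [hj]
      · simp
      · intro o' _ ho'
        simp [ho'.symm]
      · simp
    rw [hY]
    simp only [map_sum, map_smul, smul_eq_mul, Matrix.trace, Matrix.diag_apply, Matrix.mul_apply, M,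
      Matrix.of_apply]
    exact Finset.sum_congr rfl fun o _ => Finset.sum_congr rfl fun k _ =>
      Finset.sum_congr rfl fun j _ => mul_comm _ _
  refine ⟨fun o => (1 / 2 : ℝ) • (M o + (M o)ᴴ), fun o => ?_, fun Y hY => ?_⟩
  · rw [Matrix.IsHermitian, Matrix.conjTranspose_smul, star_trivial, Matrix.conjTranspose_add,
      Matrix.conjTranspose_conjTranspose, add_comm]
  · rw [hM, Complex.re_sum]
    refine Finset.sum_congr rfl fun o _ => ?_
    have h : ((M o)ᴴ * Y o).trace.re = (M o * Y o).trace.re := by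
      have : (M o)ᴴ * Y o = (Y o * M o)ᴴ := by rw [Matrix.conjTranspose_mul, (hY o).eq]
      rw [this, Matrix.trace_conjTranspose, Matrix.trace_mul_comm]
      simp
    rw [Matrix.smul_mul, Matrix.add_mul, Matrix.trace_smul, Matrix.trace_add, Complex.smul_re,
      Complex.add_re, h, smul_eq_mul]
    ring

lemma trace_mul_vecMulVec_star (R : Matrix (Fin d) (Fin d) ℂ) (w : Fin d → ℂ) :
    (R * Matrix.vecMulVec w (star w)).trace = star w ⬝ᵥ (R *ᵥ w) := by
  rw [Matrix.mul_vecMulVec, Matrix.trace_vecMulVec, dotProduct_comm]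

lemma re_star_dotProduct_self_pos {w : Fin d → ℂ} (hw : w ≠ 0) : 0 < (star w ⬝ᵥ w).re :=
  (Complex.lt_def.1 (Matrix.dotProduct_star_self_pos_iff.2 hw)).1

end SignedSums

/-! ### Compatibility of noisy dichotomic measurements -/

section Compatibility
variable {g d : ℕ}

/-- A tuple of self-adjoint contractions, scaled by `τ_*(d)`, has a joint measurement. Otherwise a
linear functional separates the tuple from the signed sums; its coefficients then violate the trace
inequality. -/
lemma exists_joint_measurement (hd : 0 < d) {A : Fin g → Matrix (Fin d) (Fin d) ℂ}
    (h1 : ∀ x, (1 - A x).PosSemidef) (h2 : ∀ x, (1 + A x).PosSemidef) :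
    ∃ F : (Fin g → Bool) → Matrix (Fin d) (Fin d) ℂ, (∀ σ, (F σ).PosSemidef) ∧ ∑ σ, F σ = 1 ∧
      ∀ x, ∑ σ, boolSign (σ x) • F σ = tauStar d • A x := by
  have hd' : (0 : ℝ) < d := by exact_mod_cast hd
  have hA (x : Fin g) : (A x).IsHermitian := by
    have := (h2 x).1.sub Matrix.isHermitian_one
    rwa [add_sub_cancel_left] at this
  let P : Option (Fin g) → Matrix (Fin d) (Fin d) ℂ := fun o =>
    (d : ℝ)⁻¹ • o.elim 1 fun x => tauStar d • A x
  have hP (o : Option (Fin g)) : (P o).IsHermitian := by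
    cases o <;> simp [P, Matrix.IsHermitian, Matrix.conjTranspose_smul, (hA _).eq]
  have hmem : (fun o j k => P o j k) ∈ signedSums g d := by
    by_contra hnot
    obtain ⟨f, u, hfu, huf⟩ := RCLike.geometric_hahn_banach_closed_point (𝕜 := ℂ)
      convex_signedSums isCompact_signedSums.isClosed hnot
    obtain ⟨R, hR, hRf⟩ := exists_isHermitian_trace_repr f.toLinearMap
    have hneg (w : Fin d → ℂ) : ∑ x, ‖star w ⬝ᵥ (R (some x) *ᵥ w)‖ ≤
        (star w ⬝ᵥ ((u • (1 : Matrix (Fin d) (Fin d) ℂ) - R none) *ᵥ w)).re := by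
      refine sum_norm_quadraticForm_le (fun x => hR (some x)) w _ fun σ => ?_
      rcases eq_or_ne w 0 with rfl | hw
      · simp
      have hw := re_star_dotProduct_self_pos hw
      -- The functional is tested on the normalized rank one matrix `w wᴴ`, placed at `σ`.
      set c : ℝ := (star w ⬝ᵥ w).re⁻¹ with hc
      let T : Matrix (Fin d) (Fin d) ℂ := c • Matrix.vecMulVec w (star w)
      have hT : T.PosSemidef := (Matrix.posSemidef_vecMulVec_self_star w).smul (by positivity)
      let Y : Option (Fin g) → Matrix (Fin d) (Fin d) ℂ := fun o => optionSign σ o • T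
      have hY (o : Option (Fin g)) : (Y o).IsHermitian := by
        simp [Y, Matrix.IsHermitian, Matrix.conjTranspose_smul, hT.1.eq]
      have hYmem : (fun o j k => Y o j k) ∈ signedSums g d := by
        refine ⟨Pi.single σ T, fun σ' => ?_, ?_, fun o j k => ?_⟩
        · rcases eq_or_ne σ' σ with rfl | h
          · simpa using hT
          · simpa [h] using Matrix.PosSemidef.zero
        · rw [Finset.sum_eq_single σ (fun σ' _ h => by simp [h]) (by simp), Pi.single_eq_same,
            Matrix.trace_smul, Matrix.trace_vecMulVec, dotProduct_comm, Complex.smul_re,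
            smul_eq_mul, hc, inv_mul_cancel₀ hw.ne']
        · rw [Finset.sum_eq_single σ (fun σ' _ h => by simp [h]) (by simp), Pi.single_eq_same]
          simp [Y]
      have hlt : (f fun o j k => Y o j k).re < u := hfu _ hYmem
      have hval : (f fun o j k => Y o j k).re = c * ((star w ⬝ᵥ (R none *ᵥ w)).re +
          ∑ x, boolSign (σ x) * (star w ⬝ᵥ (R (some x) *ᵥ w)).re) := by
        refine (hRf Y hY).trans ?_
        simp only [Y, T, Matrix.mul_smul, Matrix.trace_smul, trace_mul_vecMulVec_star,
          Complex.smul_re, smul_eq_mul, Fintype.sum_option, optionSign, one_mul, mul_add,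
          Finset.mul_sum]
        congr 1
        exact Finset.sum_congr rfl fun x _ => by ring
      rw [hval, hc, inv_mul_eq_div, div_lt_iff₀ hw] at hlt
      rw [Matrix.sub_mulVec, Matrix.smul_mulVec, Matrix.one_mulVec, dotProduct_sub, dotProduct_smul,
        Complex.sub_re, Complex.smul_re, smul_eq_mul]
      linarith
    have hcore := tauStar_mul_sum_trace_le (fun x => hR (some x)) hneg h1 h2
    have hval : (f fun o j k => P o j k).re = (d : ℝ)⁻¹ * ((R none).trace.re +
        tauStar d * ∑ x, (R (some x) * A x).trace.re) := by
      refine (hRf P hP).trans ?_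
      simp only [P, Matrix.mul_smul, Matrix.trace_smul, Complex.smul_re, smul_eq_mul,
        Fintype.sum_option, Option.elim, Matrix.mul_one, mul_add, Finset.mul_sum]
    have huf : u < (f fun o j k => P o j k).re := huf
    rw [hval, inv_mul_eq_div, lt_div_iff₀ hd'] at huf
    simp only [Matrix.trace_sub, Matrix.trace_smul, Matrix.trace_one, Complex.sub_re,
      Complex.smul_re, smul_eq_mul, Fintype.card_fin, Complex.natCast_re] at hcore
    linarith
  obtain ⟨F, hF, -, hFP⟩ := hmem
  have hsum (o : Option (Fin g)) : ∑ σ, optionSign σ o • F σ = P o := by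
    ext j k
    refine Eq.trans ?_ (hFP o j k).symm
    simp [Matrix.sum_apply]
  have hscale (o : Option (Fin g)) : ∑ σ, optionSign σ o • (d : ℝ) • F σ =
      o.elim 1 fun x => tauStar d • A x := by
    simp only [smul_comm _ (d : ℝ), ← Finset.smul_sum, hsum]
    exact smul_inv_smul₀ hd'.ne' _
  refine ⟨fun σ => (d : ℝ) • F σ, fun σ => (hF σ).smul hd'.le, ?_, fun x => hscale (some x)⟩
  simpa [optionSign] using hscale none

/-- The sign attached to an outcome of a dichotomic measurement: `+1` for outcome `0` and `-1` for
outcome `1`. -/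
def outcomeSign (a : Fin 2) : ℝ := if a = 0 then 1 else -1

lemma compatible_noisy_tauStar (hd : 0 < d) {E : Fin g → Fin 2 → Matrix (Fin d) (Fin d) ℂ}
    (hE : ∀ x, IsPOVM (E x)) :
    Compatible (k := fun _ => 2) (noisy (k := fun _ => 2) (fun _ => tauStar d) E) := by
  have hsum (x : Fin g) : E x 0 + E x 1 = 1 := by simpa [Fin.sum_univ_two] using (hE x).2
  obtain ⟨F, hF, hF1, hFA⟩ := exists_joint_measurement hd (A := fun x => E x 0 - E x 1)
    (fun x => by
      have : 1 - (E x 0 - E x 1) = E x 1 + E x 1 := by rw [← hsum x]; abel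
      rw [this]
      exact ((hE x).1 1).add ((hE x).1 1))
    (fun x => by
      have : 1 + (E x 0 - E x 1) = E x 0 + E x 0 := by rw [← hsum x]; abel
      rw [this]
      exact ((hE x).1 0).add ((hE x).1 0))
  let e := Fintype.equivFin (Fin g → Bool)
  -- Outcome `a` of the `x`-th measurement is read off the `x`-th sign of the joint outcome.
  refine ⟨Fintype.card (Fin g → Bool), fun l => F (e.symm l),
    fun x a l => (1 + outcomeSign a * boolSign (e.symm l x)) / 2, ⟨fun l => hF _, ?_⟩, ?_, ?_, ?_⟩
  · rw [Equiv.sum_comp e.symm F, hF1]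
  · intro x a l
    rcases Bool.eq_false_or_eq_true (e.symm l x) with h | h <;> fin_cases a <;>
      simp [outcomeSign, boolSign, h]
  · intro x l
    rw [Fin.sum_univ_two]
    simp only [outcomeSign, if_true, one_ne_zero, if_false]
    ring
  · intro x a
    rw [Equiv.sum_comp e.symm fun σ => ((1 + outcomeSign a * boolSign (σ x)) / 2) • F σ]
    have hsplit : ∑ σ, ((1 + outcomeSign a * boolSign (σ x)) / 2) • F σ =
        (1 / 2 : ℝ) • ∑ σ, F σ + (outcomeSign a / 2) • ∑ σ, boolSign (σ x) • F σ := by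
      rw [Finset.smul_sum, Finset.smul_sum, ← Finset.sum_add_distrib]
      refine Finset.sum_congr rfl fun σ _ => ?_
      rw [smul_smul, ← add_smul]
      congr 1; ring
    rw [hsplit, hF1, hFA, ← hsum x, noisy, ← hsum x]
    fin_cases a <;> simp [outcomeSign] <;> module

end Compatibility

end FreeSpec

theorem mainTheorem3 (g d : ℕ) (hd : 2 ≤ d) :
    (∀ B : Fin g → Matrix (Fin d) (Fin d) ℂ, (∀ i, (B i).IsHermitian) →
      FreeSpec.cube g 1 ⊆ FreeSpec.spectrahedron B 1 →
        FreeSpec.Included (FreeSpec.scale (fun _ => FreeSpec.tauStar d) (FreeSpec.cube g))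
          (FreeSpec.spectrahedron B)) ∧
    (fun _ => FreeSpec.tauStar d) ∈ FreeSpec.cubeConstants g d ∧
    (fun _ => FreeSpec.tauStar d) ∈ FreeSpec.compatibilityRegion g d := by
  have hd0 : 0 < d := by omega
  have hIcc : FreeSpec.tauStar d ∈ Set.Icc (0 : ℝ) 1 :=
    ⟨FreeSpec.tauStar_nonneg d, FreeSpec.tauStar_le_one hd0⟩
  exact ⟨fun B hB h => FreeSpec.included_scale_cube hB h,
    ⟨fun _ => hIcc, fun B hB h => FreeSpec.included_scale_cube hB h⟩,
    ⟨fun _ => hIcc, fun E hE => FreeSpec.compatible_noisy_tauStar hd0 hE⟩⟩
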